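/- Let $n\ge 0$ and let $\mathcal K^n$ be the set of convex bodies, that is, non-empty, compact, convex subsets of $\mathbb R^n$, equipped with the topology induced by the Hausdorff metric. A functional $Z:\mathcal K^n\to\mathbb R$ is called a valuation if $$Z(P)+Z(Q)=Z(P\cup Q)+Z(P\cap Q)$$ for all $P,Q\in\mathcal K^n$ such that $P\cup Q,\,P\cap Q\in\mathcal K^n$. It is called translation invariant if $Z(K+x)=Z(K)$ for all $K\in\mathcal K^n$ and $x\in\mathbb R^n$, and $j$-homogeneous if $Z(tK)=t^jZ(K)$ for all $t>0$ and $K\in\mathcal K^n$. **Theorem (McMullen).** If $Z:\mathcal K^n\to\mathbb R$ is a continuous, translation invariant valuation, then there are functionals $Z_0,\dots,Z_n:\mathcal K^n\to\mathbb R$ such that $$Z=Z_0+\dots+Z_n$$ and, for each $0\le j\le n$, $Z_j$ is a continuous, translation invariant, $j$-homogeneous valuation. -/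

import Mathlib

open scoped Pointwise

/-- Euclidean space `ℝⁿ`. -/
abbrev Eucl (n : ℕ) : Type := EuclideanSpace ℝ (Fin n)

/-- The translate `x + K` of a convex body. -/
def ConvexBody.translate {n : ℕ} (x : Eucl n) (K : ConvexBody (Eucl n)) :
    ConvexBody (Eucl n) where
  carrier := x +ᵥ (K : Set (Eucl n))
  convex' := K.convex.vadd x
  isCompact' := K.isCompact.vadd x
  nonempty' := K.nonempty.vadd_set

/-- `Z(P) + Z(Q) = Z(P ∪ Q) + Z(P ∩ Q)` whenever `P`, `Q`, `P ∪ Q` and `P ∩ Q` are convex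
bodies. Convex bodies are nonempty, so `Z` needs no value at the empty set. -/
def IsValuation {n : ℕ} (Z : ConvexBody (Eucl n) → ℝ) : Prop :=
  ∀ P Q U I : ConvexBody (Eucl n),
    (U : Set (Eucl n)) = (P : Set (Eucl n)) ∪ (Q : Set (Eucl n)) →
    (I : Set (Eucl n)) = (P : Set (Eucl n)) ∩ (Q : Set (Eucl n)) →
      Z P + Z Q = Z U + Z I

/-- `Z(x + K) = Z(K)` for every vector `x` and every convex body `K`. -/
def IsTranslationInvariant {n : ℕ} (Z : ConvexBody (Eucl n) → ℝ) : Prop :=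
  ∀ (x : Eucl n) (K : ConvexBody (Eucl n)), Z (K.translate x) = Z K

/-- `Z(t K) = t ^ p Z(K)` for every `t > 0` and every convex body `K`. -/
def IsHomogeneousOfDegree {n : ℕ} (p : ℝ) (Z : ConvexBody (Eucl n) → ℝ) : Prop :=
  ∀ (t : ℝ) (K : ConvexBody (Eucl n)), 0 < t → Z (t • K) = t ^ p * Z K

/-! The core fact is that `t ↦ Z (t • K)` is a polynomial of degree at most `n` for `t ≥ 0`; its
coefficients are the homogeneous parts. For a polytope and integer `t`, induct on the number of
points spanning it. With one point `v` moved to the origin, the polytope is a cone `C` over the hull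
`L` of the others. Then `(k + 1) • C` is the union of `k • C` and `k • L + C`, which meet in `k •
L`. So the difference of consecutive values is `Z (k • L + C) - Z (k • L)`, polynomial by induction
applied to `Z` and to `Z (· + C)` (`IsValuation.apply_smul_cone`,
`exists_polynomial_of_convexHull`). The degree is bounded by growth: Blaschke selection bounds `Z`
on bodies of unit width, and cutting `k • K` into slabs gives `O(k ^ n)`
(`IsValuation.exists_growth_bound`). Rescaling, continuity and density of polytopes extend this to
real `t` and all bodies. By interpolation each coefficient is a fixed linear combination of `Z (K),
…, Z ((n + 1) • K)`, so it inherits the properties of `Z`. -/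

namespace Polynomial

/-! ### Polynomial sequences: summation and growth -/

theorem exists_eval_eq_sum_range (p : ℝ[X]) :
    ∃ q : ℝ[X], ∀ k : ℕ, q.eval (k : ℝ) = ∑ i ∈ Finset.range k, p.eval (i : ℝ) := by
  induction p using Polynomial.induction_on' with
  | add p q hp hq =>
    obtain ⟨p', hp'⟩ := hp
    obtain ⟨q', hq'⟩ := hq
    exact ⟨p' + q', fun k => by simp [hp', hq', Finset.sum_add_distrib]⟩
  | monomial d a =>
    -- Faulhaber's formula for power sums.
    refine ⟨C (a / (d + 1)) * ((bernoulli d.succ).map (algebraMap ℚ ℝ) -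
      C ((_root_.bernoulli d.succ : ℚ) : ℝ)), fun k => ?_⟩
    have h := congrArg (fun x : ℚ => (x : ℝ)) (sum_range_pow_eq_bernoulli_sub k d)
    have h2 : ((bernoulli d.succ).map (algebraMap ℚ ℝ)).eval (k : ℝ)
        = (((bernoulli d.succ).eval (k : ℚ) : ℚ) : ℝ) := by
      simpa using eval_natCast_map (algebraMap ℚ ℝ) (bernoulli d.succ) k
    push_cast at h
    have hd : (d : ℝ) + 1 ≠ 0 := by positivity
    rw [eval_mul, eval_sub, eval_C, eval_C, h2, ← h]
    simp only [eval_monomial, ← Finset.mul_sum]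
    field_simp

theorem exists_eval_eq_of_sub_eq {f : ℕ → ℝ} {p : ℝ[X]}
    (h : ∀ k : ℕ, f (k + 1) - f k = p.eval (k : ℝ)) :
    ∃ q : ℝ[X], ∀ k : ℕ, f k = q.eval (k : ℝ) := by
  obtain ⟨q, hq⟩ := p.exists_eval_eq_sum_range
  refine ⟨q + C (f 0), fun k => ?_⟩
  rw [eval_add, eval_C, hq, ← Finset.sum_congr rfl fun i _ => h i, Finset.sum_range_sub]
  ring

theorem degree_le_of_abs_eval_le {q : ℝ[X]} {A c : ℝ} {n : ℕ} (hc : 0 ≤ c)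
    (h : ∀ k : ℕ, |q.eval (k : ℝ)| ≤ A * (c * k + 1) ^ n) : q.degree ≤ n := by
  by_contra! hn
  set Q : ℝ[X] := (C c * X + 1) ^ n with hQ
  have hQeval (x : ℝ) : Q.eval x = (c * x + 1) ^ n := by simp [hQ]
  have hdeg : Q.degree ≤ n := by
    have h1 : (C c * X + 1 : ℝ[X]).degree ≤ 1 := by
      simpa using degree_linear_le (a := c) (b := 1)
    refine (degree_pow_le _ _).trans ?_
    simpa using nsmul_le_nsmul_right h1 n
  have hQ0 : Q ≠ 0 := fun h0 => by simpa [h0] using hQeval 0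
  have htend := (abs_div_tendsto_atTop_atTop_of_degree_gt q Q (hdeg.trans_lt hn) hQ0).comp
    (tendsto_natCast_atTop_atTop (R := ℝ))
  obtain ⟨k, hk⟩ := (htend.eventually_gt_atTop A).exists
  have hpos : 0 < Q.eval (k : ℝ) := by rw [hQeval]; positivity
  have h3 := h k
  rw [← hQeval] at h3
  rw [Function.comp_apply, abs_div, abs_of_pos hpos, lt_div_iff₀ hpos] at hk
  exact hk.not_ge h3

end Polynomial

/-! ### Minkowski operations and the Hausdorff metric on convex bodies -/

namespace ConvexBody

variable {n : ℕ}

theorem mem_translate {x y : Eucl n} {K : ConvexBody (Eucl n)} :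
    y ∈ K.translate x ↔ y - x ∈ K := by
  change y ∈ x +ᵥ (K : Set (Eucl n)) ↔ y - x ∈ (K : Set (Eucl n))
  rw [Set.mem_vadd_set_iff_neg_vadd_mem, vadd_eq_add, neg_add_eq_sub]

theorem translate_eq_singleton_vadd (x : Eucl n) (K : ConvexBody (Eucl n)) :
    (K.translate x : Set (Eucl n)) = {x} + (K : Set (Eucl n)) := by
  rw [Set.singleton_add]; rfl

theorem mem_add {y : Eucl n} {K L : ConvexBody (Eucl n)} :
    y ∈ K + L ↔ ∃ a ∈ K, ∃ b ∈ L, a + b = y :=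
  Set.mem_add

theorem mem_smul {y : Eucl n} {t : ℝ} {K : ConvexBody (Eucl n)} :
    y ∈ t • K ↔ ∃ a ∈ K, t • a = y :=
  Set.mem_smul_set

theorem translate_add (x : Eucl n) (K L : ConvexBody (Eucl n)) :
    K.translate x + L = (K + L).translate x := by
  apply ConvexBody.ext
  rw [coe_add, translate_eq_singleton_vadd, translate_eq_singleton_vadd, coe_add, add_assoc]

theorem smul_translate (t : ℝ) (x : Eucl n) (K : ConvexBody (Eucl n)) :
    t • K.translate x = (t • K).translate (t • x) := by
  apply ConvexBody.ext
  rw [coe_smul, translate_eq_singleton_vadd, translate_eq_singleton_vadd, coe_smul, smul_add,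
    Set.smul_set_singleton]

/-- Minkowski addition distributes over the intersection of two bodies with convex union. -/
theorem inter_add_eq {P Q U I : ConvexBody (Eucl n)}
    (hU : (U : Set (Eucl n)) = (P : Set (Eucl n)) ∪ (Q : Set (Eucl n)))
    (hI : (I : Set (Eucl n)) = (P : Set (Eucl n)) ∩ (Q : Set (Eucl n)))
    (R : ConvexBody (Eucl n)) :
    ((I + R : ConvexBody (Eucl n)) : Set (Eucl n))
      = ((P + R : ConvexBody (Eucl n)) : Set (Eucl n)) ∩ (Q + R : ConvexBody (Eucl n)) := by
  simp only [coe_add]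
  refine subset_antisymm (by rw [hI]; exact Set.inter_add_subset) ?_
  rintro x ⟨⟨p, hp, r, hr, rfl⟩, q, hq, s, hs, hx⟩
  have hsub : segment ℝ p q ⊆ (P : Set (Eucl n)) ∪ Q := by
    rw [← hU]
    refine U.convex.segment_subset ?_ ?_ <;> rw [hU]
    exacts [Or.inl hp, Or.inr hq]
  -- The segment is connected and covered by the closed sets `P` and `Q`, so it meets `P ∩ Q`; the
  -- same weights applied to `r`, `s` recover the given point.
  have hconn := (convex_segment (𝕜 := ℝ) p q).isPreconnected
  rw [isPreconnected_closed_iff] at hconn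
  obtain ⟨y, hy, hyP, hyQ⟩ := hconn P Q P.isClosed Q.isClosed hsub
    ⟨p, left_mem_segment ℝ p q, hp⟩ ⟨q, right_mem_segment ℝ p q, hq⟩
  obtain ⟨a, b, ha, hb, hab, rfl⟩ := hy
  refine ⟨a • p + b • q, by rw [hI]; exact ⟨hyP, hyQ⟩, a • r + b • s,
    R.convex hr hs ha hb hab, ?_⟩
  change a • p + b • q + (a • r + b • s) = p + r
  change q + s = p + r at hx
  calc a • p + b • q + (a • r + b • s) = a • (p + r) + b • (q + s) := by module
    _ = p + r := by rw [hx, ← add_smul, hab, one_smul]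

theorem dist_le_of_mem_dist {K L : ConvexBody (Eucl n)} {r : ℝ} (hr : 0 ≤ r)
    (h₁ : ∀ x ∈ K, ∃ y ∈ L, dist x y ≤ r) (h₂ : ∀ x ∈ L, ∃ y ∈ K, dist x y ≤ r) :
    dist K L ≤ r :=
  Metric.hausdorffDist_le_of_mem_dist hr h₁ h₂

theorem exists_dist_le (K L : ConvexBody (Eucl n)) {x : Eucl n} (hx : x ∈ K) :
    ∃ y ∈ L, dist x y ≤ dist K L := by
  obtain ⟨y, hy, hxy⟩ := L.isCompact.exists_infDist_eq_dist L.nonempty x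
  exact ⟨y, hy, hxy ▸ Metric.infDist_le_hausdorffDist_of_mem hx hausdorffEDist_ne_top⟩

theorem dist_smul_smul_le (t : ℝ) (K L : ConvexBody (Eucl n)) :
    dist (t • K) (t • L) ≤ |t| * dist K L := by
  have key (K L : ConvexBody (Eucl n)) (x : Eucl n) (hx : x ∈ t • K) :
      ∃ y ∈ t • L, dist x y ≤ |t| * dist K L := by
    obtain ⟨a, ha, rfl⟩ := mem_smul.1 hx
    obtain ⟨b, hb, hab⟩ := exists_dist_le K L ha
    refine ⟨t • b, mem_smul.2 ⟨b, hb, rfl⟩, ?_⟩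
    rw [dist_smul₀, Real.norm_eq_abs]
    gcongr
  refine dist_le_of_mem_dist (by positivity) (key K L) fun x hx => ?_
  rw [dist_comm]
  exact key L K x hx

theorem continuous_const_smul (t : ℝ) : Continuous fun K : ConvexBody (Eucl n) => t • K :=
  (LipschitzWith.of_dist_le_mul (K := ‖t‖₊) fun K L => by
    simpa using dist_smul_smul_le t K L).continuous

theorem continuous_smul_const (K : ConvexBody (Eucl n)) : Continuous fun t : ℝ => t • K := by
  obtain ⟨R, hR, hK⟩ := K.isBounded.exists_pos_norm_le
  refine (LipschitzWith.of_dist_le_mul (K := R.toNNReal) fun s t => ?_).continuous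
  rw [Real.coe_toNNReal _ hR.le]
  have key (s t : ℝ) (x : Eucl n) (hx : x ∈ s • K) : ∃ y ∈ t • K, dist x y ≤ R * dist s t := by
    obtain ⟨a, ha, rfl⟩ := mem_smul.1 hx
    refine ⟨t • a, mem_smul.2 ⟨a, ha, rfl⟩, ?_⟩
    rw [dist_eq_norm, ← sub_smul, norm_smul, mul_comm, Real.dist_eq, Real.norm_eq_abs]
    gcongr
    exact hK a ha
  refine dist_le_of_mem_dist (by positivity) (key s t) fun x hx => ?_
  rw [dist_comm s t]
  exact key t s x hx

/-- Polytopes are dense among the convex bodies. -/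
theorem exists_polytope_dist_le (K : ConvexBody (Eucl n)) {ε : ℝ} (hε : 0 < ε) :
    ∃ (s : Finset (Eucl n)) (P : ConvexBody (Eucl n)), s.Nonempty ∧
      (P : Set (Eucl n)) = convexHull ℝ (s : Set (Eucl n)) ∧ dist P K ≤ ε := by
  obtain ⟨t, htK, htfin, hcover⟩ := finite_cover_balls_of_compact K.isCompact hε
  obtain ⟨x, hx⟩ := K.nonempty
  have hne : t.Nonempty := by
    obtain ⟨y, hy, -⟩ := Set.mem_iUnion₂.1 (hcover hx)
    exact ⟨y, hy⟩
  lift t to Finset (Eucl n) using htfin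
  let P : ConvexBody (Eucl n) := ⟨convexHull ℝ (t : Set (Eucl n)), convex_convexHull ℝ _,
    t.finite_toSet.isCompact_convexHull ℝ, hne.convexHull⟩
  refine ⟨t, P, Finset.coe_nonempty.1 hne, rfl, dist_le_of_mem_dist hε.le ?_ ?_⟩
  · exact fun y hy => ⟨y, convexHull_min htK K.convex hy, by simpa using hε.le⟩
  · intro y hy
    obtain ⟨z, hz, hyz⟩ := Set.mem_iUnion₂.1 (hcover hy)
    exact ⟨z, subset_convexHull ℝ _ hz, (Metric.mem_ball.1 hyz).le⟩

/-- A convex body as a nonempty compact set. -/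
def toNonemptyCompacts (K : ConvexBody (Eucl n)) :
    TopologicalSpace.NonemptyCompacts (Eucl n) :=
  ⟨⟨K, K.isCompact⟩, K.nonempty⟩

theorem isometry_toNonemptyCompacts : Isometry (toNonemptyCompacts (n := n)) :=
  Isometry.of_dist_eq fun _ _ => rfl

/-- Convexity survives Hausdorff limits: approximate two points within `ε / 2` by points of a convex
body, combine there, and return at a total cost of `ε`. -/
theorem isClosed_range_toNonemptyCompacts :
    IsClosed (Set.range (toNonemptyCompacts (n := n))) := by
  refine isClosed_of_closure_subset fun T hT => ?_
  have hconv : Convex ℝ (T : Set (Eucl n)) := by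
    intro x hx y hy a b ha hb hab
    rw [T.isCompact.isClosed.mem_iff_infDist_zero T.nonempty]
    refine le_antisymm (le_of_forall_pos_le_add fun ε hε => ?_) Metric.infDist_nonneg
    obtain ⟨_, ⟨K, rfl⟩, hTK⟩ := Metric.mem_closure_iff.1 hT (ε / 2) (half_pos hε)
    have hfin : Metric.hausdorffEDist (T : Set (Eucl n)) K ≠ ⊤ :=
      Metric.hausdorffEDist_ne_top_of_nonempty_of_bounded T.nonempty K.nonempty
        T.isCompact.isBounded K.isBounded
    have hd : Metric.hausdorffDist (T : Set (Eucl n)) K < ε / 2 := hTK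
    obtain ⟨x', hx', hxx⟩ := Metric.exists_dist_lt_of_hausdorffDist_lt hx hd hfin
    obtain ⟨y', hy', hyy⟩ := Metric.exists_dist_lt_of_hausdorffDist_lt hy hd hfin
    obtain ⟨z, hz, hzz⟩ := Metric.exists_dist_lt_of_hausdorffDist_lt'
      (K.convex hx' hy' ha hb hab) hd hfin
    have h1 : dist (a • x + b • y) (a • x' + b • y') ≤ ε / 2 := calc
      _ ≤ dist (a • x) (a • x') + dist (b • y) (b • y') := dist_add_add_le _ _ _ _
      _ = a * dist x x' + b * dist y y' := by
        rw [dist_smul₀, dist_smul₀, Real.norm_of_nonneg ha, Real.norm_of_nonneg hb]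
      _ ≤ a * (ε / 2) + b * (ε / 2) := by gcongr
      _ = ε / 2 := by rw [← add_mul, hab, one_mul]
    have h2 := dist_triangle (a • x + b • y) (a • x' + b • y') z
    rw [dist_comm] at hzz
    linarith [Metric.infDist_le_dist_of_mem (x := a • x + b • y) hz]
  exact ⟨⟨T, hconv, T.isCompact, T.nonempty⟩, rfl⟩

/-- **Blaschke selection theorem.** -/
theorem isCompact_setOf_subset {B : Set (Eucl n)} (hB : IsCompact B) :
    IsCompact {K : ConvexBody (Eucl n) | (K : Set (Eucl n)) ⊆ B} := by
  have hemb : Topology.IsClosedEmbedding (toNonemptyCompacts (n := n)) :=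
    ⟨isometry_toNonemptyCompacts.isEmbedding, isClosed_range_toNonemptyCompacts⟩
  exact hemb.isCompact_preimage
    (TopologicalSpace.NonemptyCompacts.isCompact_subsets_of_isCompact hB)

end ConvexBody

/-! ### Integer dilates of polytopes -/

variable {n : ℕ} {Z : ConvexBody (Eucl n) → ℝ}

theorem IsValuation.comp_add (hval : IsValuation Z) (R : ConvexBody (Eucl n)) :
    IsValuation fun K => Z (K + R) := fun P Q U I hU hI =>
  hval (P + R) (Q + R) (U + R) (I + R)
    (by simp only [ConvexBody.coe_add, hU, Set.union_add]) (ConvexBody.inter_add_eq hU hI R)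

theorem IsTranslationInvariant.comp_add (htrans : IsTranslationInvariant Z)
    (R : ConvexBody (Eucl n)) : IsTranslationInvariant fun K => Z (K + R) := fun x K => by
  simp only [ConvexBody.translate_add, htrans x]

/-- Slicing a dilated cone with apex `0` over `L` at height `k`. -/
theorem IsValuation.apply_smul_cone (hval : IsValuation Z) {C L : ConvexBody (Eucl n)}
    (hC : ∀ x, x ∈ C ↔ ∃ t : ℝ, 0 ≤ t ∧ t ≤ 1 ∧ ∃ l ∈ L, t • l = x) {k : ℝ} (hk : 0 ≤ k) :
    Z (k • C) + Z (k • L + C) = Z ((k + 1) • C) + Z (k • L) := by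
  have hdil (r : ℝ) (hr : 0 ≤ r) (x : Eucl n) :
      x ∈ r • C ↔ ∃ t : ℝ, 0 ≤ t ∧ t ≤ r ∧ ∃ l ∈ L, t • l = x := by
    rw [ConvexBody.mem_smul]
    constructor
    · rintro ⟨y, hy, rfl⟩
      obtain ⟨t, ht0, ht1, l, hl, rfl⟩ := (hC y).1 hy
      exact ⟨r * t, by positivity, mul_le_of_le_one_right hr ht1, l, hl, by rw [mul_smul]⟩
    · rintro ⟨t, ht0, htr, l, hl, rfl⟩
      rcases hr.eq_or_lt with rfl | hr
      · obtain rfl : t = 0 := le_antisymm htr ht0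
        exact ⟨l, (hC l).2 ⟨1, by simp, le_rfl, l, hl, one_smul _ _⟩, rfl⟩
      · refine ⟨(t / r) • l, (hC _).2 ⟨t / r, by positivity, ?_, l, hl, rfl⟩, ?_⟩
        · rwa [div_le_one hr]
        · rw [smul_smul, mul_div_cancel₀ _ hr.ne']
  have hsum (x : Eucl n) :
      x ∈ k • L + C ↔ ∃ t : ℝ, k ≤ t ∧ t ≤ k + 1 ∧ ∃ l ∈ L, t • l = x := by
    rw [ConvexBody.mem_add]
    constructor
    · rintro ⟨a, ha, b, hb, rfl⟩
      obtain ⟨l, hl, rfl⟩ := ConvexBody.mem_smul.1 ha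
      obtain ⟨t, ht0, ht1, m, hm, rfl⟩ := (hC b).1 hb
      refine ⟨k + t, by linarith, by linarith, ?_⟩
      have hmem : k • l + t • m ∈ (k + t) • (L : Set (Eucl n)) := by
        rw [L.convex.add_smul hk ht0]
        exact Set.add_mem_add (Set.smul_mem_smul_set hl) (Set.smul_mem_smul_set hm)
      exact Set.mem_smul_set.1 hmem
    · rintro ⟨t, htk, ht1, l, hl, rfl⟩
      refine ⟨k • l, ConvexBody.mem_smul.2 ⟨l, hl, rfl⟩, (t - k) • l,
        (hC _).2 ⟨t - k, by linarith, by linarith, l, hl, rfl⟩, ?_⟩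
      rw [← add_smul, add_sub_cancel]
  refine hval (k • C) (k • L + C) ((k + 1) • C) (k • L) ?_ ?_
  · ext x
    simp only [Set.mem_union, SetLike.mem_coe, hdil k hk, hdil (k + 1) (by linarith), hsum]
    constructor
    · rintro ⟨t, h0, h1, h⟩
      rcases le_total t k with htk | htk
      exacts [Or.inl ⟨t, h0, htk, h⟩, Or.inr ⟨t, htk, h1, h⟩]
    · rintro (⟨t, h0, h1, h⟩ | ⟨t, h0, h1, h⟩)
      exacts [⟨t, h0, by linarith, h⟩, ⟨t, by linarith, h1, h⟩]
  · ext x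
    simp only [Set.mem_inter_iff, SetLike.mem_coe, hdil k hk, hsum]
    constructor
    · intro hx
      obtain ⟨l, hl, rfl⟩ := ConvexBody.mem_smul.1 hx
      exact ⟨⟨k, hk, le_rfl, l, hl, rfl⟩, k, le_rfl, by linarith, l, hl, rfl⟩
    · rintro ⟨⟨s, hs0, hsk, l, hl, rfl⟩, t, htk, -, m, hm, hmx⟩
      rw [ConvexBody.mem_smul]
      rcases htk.eq_or_lt with rfl | htk
      · exact ⟨m, hm, hmx⟩
      have ht : 0 < t := hk.trans_lt htk
      have hm' : m = (s / t) • l := by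
        rw [div_eq_inv_mul, mul_smul, ← hmx, inv_smul_smul₀ ht.ne']
      rcases hk.eq_or_lt with rfl | hk
      · obtain rfl : s = 0 := le_antisymm hsk hs0
        exact ⟨m, hm, by simp⟩
      -- `s / k` lies between `s / t` and `1`
      have hst : s < t := hsk.trans_lt htk
      have hts : 0 < t - s := sub_pos.2 hst
      refine ⟨(s / k) • l, ?_, by rw [smul_smul, mul_div_cancel₀ _ hk.ne']⟩
      -- The weights solve `a + b = 1` and `a + b * (s / t) = s / k`.
      have hconv := L.convex hl hm (a := s * (t - k) / (k * (t - s)))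
        (b := t * (k - s) / (k * (t - s)))
        (div_nonneg (mul_nonneg hs0 (by linarith)) (by positivity))
        (div_nonneg (mul_nonneg ht.le (by linarith)) (by positivity))
        (by field_simp; ring)
      rw [hm', smul_smul, ← add_smul] at hconv
      have hcoef : s * (t - k) / (k * (t - s)) + t * (k - s) / (k * (t - s)) * (s / t)
          = s / k := by
        field_simp
        ring
      rwa [hcoef] at hconv

/-- Along the integer dilates of a polytope, a translation invariant valuation is polynomial. -/
theorem exists_polynomial_of_convexHull (s : Finset (Eucl n)) (hs : s.Nonempty) :
    ∀ Z : ConvexBody (Eucl n) → ℝ, IsTranslationInvariant Z → IsValuation Z →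
      ∀ P : ConvexBody (Eucl n), (P : Set (Eucl n)) = convexHull ℝ (s : Set (Eucl n)) →
        ∃ q : Polynomial ℝ, ∀ k : ℕ, Z ((k : ℝ) • P) = q.eval (k : ℝ) := by
  induction hs using Finset.Nonempty.cons_induction with
  | singleton v =>
    intro Z htrans _ P hP
    refine ⟨Polynomial.C (Z 0), fun k => ?_⟩
    have : (k : ℝ) • P = (0 : ConvexBody (Eucl n)).translate ((k : ℝ) • v) := by
      apply ConvexBody.ext
      rw [ConvexBody.translate_eq_singleton_vadd]
      simp [hP]
    rw [this, htrans, Polynomial.eval_C]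
  | cons v s hv hs ih =>
    intro Z htrans hval P hP
    let S : ConvexBody (Eucl n) := ⟨convexHull ℝ (s : Set (Eucl n)), convex_convexHull ℝ _,
      s.finite_toSet.isCompact_convexHull ℝ, (Finset.coe_nonempty.2 hs).convexHull⟩
    let C := P.translate (-v)
    let L := S.translate (-v)
    have hC (x : Eucl n) : x ∈ C ↔ ∃ t : ℝ, 0 ≤ t ∧ t ≤ 1 ∧ ∃ l ∈ L, t • l = x := by
      have hmem (y : Eucl n) : y ∈ P ↔ ∃ w ∈ S, y ∈ segment ℝ v w := by
        rw [← SetLike.mem_coe, hP, Finset.coe_cons, convexHull_insert (𝕜 := ℝ) (Finset.coe_nonempty.2 hs),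
          convexJoin_singleton_left]
        simp only [Set.mem_iUnion, exists_prop]
        rfl
      rw [ConvexBody.mem_translate, hmem]
      constructor
      · rintro ⟨w, hw, a, b, ha, hb, hab, hx⟩
        refine ⟨b, hb, by linarith, w - v, ConvexBody.mem_translate.2 (by simpa using hw), ?_⟩
        obtain rfl : a = 1 - b := by linarith
        rw [sub_neg_eq_add] at hx
        rw [eq_sub_of_add_eq hx.symm]
        module
      · rintro ⟨t, h0, h1, l, hl, rfl⟩
        refine ⟨l - -v, ConvexBody.mem_translate.1 hl, 1 - t, t, by linarith, h0, by ring, ?_⟩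
        module
    obtain ⟨q₁, hq₁⟩ := ih Z htrans hval S rfl
    -- The valuation changes here to `K ↦ Z (K + C)`, which is why the induction quantifies over
    -- `Z`.
    obtain ⟨q₂, hq₂⟩ := ih _ (htrans.comp_add C) (hval.comp_add C) S rfl
    refine Polynomial.exists_eval_eq_of_sub_eq (p := q₂ - q₁) fun k => ?_
    have hcone := hval.apply_smul_cone hC (Nat.cast_nonneg k)
    simp only [C, L, ConvexBody.smul_translate, htrans _ _] at hcone
    have h2 := hq₂ k
    rw [ConvexBody.translate_add, htrans] at hcone
    rw [Polynomial.eval_sub, ← hq₁, ← h2]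
    push_cast
    linarith

/-! ### Growth of order `k ^ n` under dilation -/

theorem IsTranslationInvariant.exists_bound_of_unit_width (htrans : IsTranslationInvariant Z)
    (hcont : Continuous Z) : ∃ A : ℝ, 0 ≤ A ∧ ∀ K : ConvexBody (Eucl n),
      (∀ i, ∀ x ∈ K, ∀ y ∈ K, x i - y i ≤ 1) → |Z K| ≤ A := by
  obtain ⟨A, hA⟩ := (ConvexBody.isCompact_setOf_subset
    (isCompact_closedBall (0 : Eucl n) √n)).exists_bound_of_continuousOn hcont.continuousOn
  refine ⟨max A 0, le_max_right _ _, fun K hK => ?_⟩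
  obtain ⟨x, hx⟩ := K.nonempty
  -- With a point of the body moved to the origin, all coordinates are at most `1` in absolute
  -- value, so the body lies in the ball of radius `√n`.
  rw [← htrans (-x) K]
  refine (hA _ fun y hy => ?_).trans (le_max_left _ _)
  have hy' : y + x ∈ K := by simpa using ConvexBody.mem_translate.1 hy
  rw [mem_closedBall_zero_iff, EuclideanSpace.norm_eq]
  apply Real.sqrt_le_sqrt
  calc ∑ i, ‖y i‖ ^ 2 ≤ ∑ _i : Fin n, (1 : ℝ) := by
        refine Finset.sum_le_sum fun i _ => ?_
        have h1 := hK i _ hy' x hx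
        have h2 := hK i x hx _ hy'
        simp only [PiLp.add_apply] at h1 h2
        rw [Real.norm_eq_abs, sq_le_one_iff_abs_le_one, abs_abs, abs_le]
        constructor <;> linarith
    _ = n := by simp

/-- Cutting a body by a coordinate hyperplane that meets it. -/
theorem IsValuation.exists_cut (hval : IsValuation Z) (K : ConvexBody (Eucl n)) (i : Fin n)
    {c : ℝ} (h₁ : ∃ x ∈ K, x i ≤ c) (h₂ : ∃ x ∈ K, c ≤ x i) :
    ∃ K₁ K₂ K₀ : ConvexBody (Eucl n), (∀ x, x ∈ K₁ ↔ x ∈ K ∧ x i ≤ c) ∧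
      (∀ x, x ∈ K₂ ↔ x ∈ K ∧ c ≤ x i) ∧ (∀ x, x ∈ K₀ ↔ x ∈ K ∧ x i = c) ∧
      Z K₁ + Z K₂ = Z K + Z K₀ := by
  have hc : Continuous fun x : Eucl n => x i := by fun_prop
  have hlin : IsLinearMap ℝ fun x : Eucl n => x i := ⟨fun _ _ => rfl, fun _ _ => rfl⟩
  let K₁ : ConvexBody (Eucl n) := ⟨K ∩ {x | x i ≤ c}, K.convex.inter (convex_halfSpace_le hlin c),
    K.isCompact.inter_right (isClosed_le hc continuous_const), h₁⟩
  let K₂ : ConvexBody (Eucl n) := ⟨K ∩ {x | c ≤ x i}, K.convex.inter (convex_halfSpace_ge hlin c),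
    K.isCompact.inter_right (isClosed_le continuous_const hc), h₂⟩
  have h₀ : ((K : Set (Eucl n)) ∩ {x | x i = c}).Nonempty := by
    obtain ⟨x, hx, hxc⟩ := h₁
    obtain ⟨y, hy, hyc⟩ := h₂
    exact K.convex.isPreconnected.intermediate_value hx hy hc.continuousOn ⟨hxc, hyc⟩
  let K₀ : ConvexBody (Eucl n) := ⟨K ∩ {x | x i = c}, K.convex.inter (convex_hyperplane hlin c),
    K.isCompact.inter_right (isClosed_eq hc continuous_const), h₀⟩
  refine ⟨K₁, K₂, K₀, fun _ => Iff.rfl, fun _ => Iff.rfl, fun _ => Iff.rfl,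
    hval K₁ K₂ K K₀ ?_ ?_⟩
  · ext x
    change x ∈ K ↔ (x ∈ K ∧ x i ≤ c) ∨ (x ∈ K ∧ c ≤ x i)
    have := le_total (x i) c
    tauto
  · ext x
    change (x ∈ K ∧ x i = c) ↔ (x ∈ K ∧ x i ≤ c) ∧ (x ∈ K ∧ c ≤ x i)
    rw [le_antisymm_iff]
    tauto

/-- Cutting a body of width at most `m + 1` into slabs of width at most `1`. -/
theorem IsValuation.abs_le_of_slabs (hval : IsValuation Z) (i : Fin n) {B : ℝ} (m : ℕ) :
    ∀ K : ConvexBody (Eucl n),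
      (∀ L : ConvexBody (Eucl n), L ≤ K → (∀ x ∈ L, ∀ y ∈ L, x i - y i ≤ 1) → |Z L| ≤ B) →
      (∀ x ∈ K, ∀ y ∈ K, x i - y i ≤ m + 1) → |Z K| ≤ (2 * m + 1) * B := by
  induction m with
  | zero =>
    intro K hB hK
    simpa using hB K le_rfl (by simpa using hK)
  | succ m ih =>
    intro K hB hK
    have hc : Continuous fun x : Eucl n => x i := by fun_prop
    obtain ⟨x₀, hx₀, hmin⟩ := K.isCompact.exists_isMinOn K.nonempty hc.continuousOn
    replace hmin : ∀ x ∈ K, x₀ i ≤ x i := hmin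
    have hsmall (L : ConvexBody (Eucl n)) (hL : L ≤ K) (h : ∀ x ∈ L, x i ≤ x₀ i + (m + 1)) :
        |Z L| ≤ (2 * m + 1) * B := by
      refine ih L (fun M hM => hB M (hM.trans hL)) fun x hx y hy => ?_
      linarith [h x hx, hmin y (hL hy)]
    -- The section at the minimum has width zero, so `B` bounds an absolute value.
    have hB0 : 0 ≤ B := by
      obtain ⟨K₁, K₂, K₀, -, -, h₀, -⟩ := hval.exists_cut K i (c := x₀ i)
        ⟨x₀, hx₀, le_rfl⟩ ⟨x₀, hx₀, le_rfl⟩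
      refine (abs_nonneg _).trans (hB K₀ (fun x hx => ((h₀ x).1 hx).1) fun x hx y hy => ?_)
      rw [((h₀ x).1 hx).2, ((h₀ y).1 hy).2]
      simp
    by_cases hex : ∃ x ∈ K, x₀ i + (m + 1) ≤ x i
    -- Each cut costs one slab `K₂` and one section `K₀`, that is `2 * B`; hence the factor `2 * m +
    -- 1`.
    · obtain ⟨K₁, K₂, K₀, h₁, h₂, h₀, hZ⟩ := hval.exists_cut K i (c := x₀ i + (m + 1))
        ⟨x₀, hx₀, by linarith [(Nat.cast_nonneg m : (0 : ℝ) ≤ m)]⟩ hex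
      have b₁ := hsmall K₁ (fun x hx => ((h₁ x).1 hx).1) fun x hx => ((h₁ x).1 hx).2
      have b₂ := hB K₂ (fun x hx => ((h₂ x).1 hx).1) fun x hx y hy => by
        have h3 := hK x ((h₂ x).1 hx).1 x₀ hx₀
        have h4 := ((h₂ y).1 hy).2
        push_cast at h3
        linarith
      have b₀ := hB K₀ (fun x hx => ((h₀ x).1 hx).1) fun x hx y hy => by
        rw [((h₀ x).1 hx).2, ((h₀ y).1 hy).2]
        simp
      rw [abs_le] at b₁ b₂ b₀ ⊢
      push_cast
      constructor <;> linarith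
    · push Not at hex
      refine (hsmall K le_rfl fun x hx => (hex x hx).le).trans ?_
      push_cast
      linarith

/-- Slabs are cut one coordinate at a time. Pieces are subsets, so they keep the width bounds in the
other coordinates, and each direction contributes a factor `2 * m + 1`. -/
theorem IsValuation.abs_le_of_width_le (hval : IsValuation Z) {A : ℝ}
    (hA : ∀ K : ConvexBody (Eucl n), (∀ i, ∀ x ∈ K, ∀ y ∈ K, x i - y i ≤ 1) → |Z K| ≤ A)
    (m : ℕ) (K : ConvexBody (Eucl n)) (hK : ∀ i, ∀ x ∈ K, ∀ y ∈ K, x i - y i ≤ m + 1) :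
    |Z K| ≤ A * (2 * m + 1) ^ n := by
  have key (s : Finset (Fin n)) : ∀ K : ConvexBody (Eucl n),
      (∀ i ∈ s, ∀ x ∈ K, ∀ y ∈ K, x i - y i ≤ m + 1) →
      (∀ i ∉ s, ∀ x ∈ K, ∀ y ∈ K, x i - y i ≤ 1) → |Z K| ≤ A * (2 * m + 1) ^ s.card := by
    induction s using Finset.cons_induction with
    | empty =>
      intro K _ h
      simpa using hA K fun i => h i (Finset.notMem_empty i)
    | cons i s hi ih =>
      intro K h₁ h₂
      rw [Finset.card_cons, pow_succ, ← mul_assoc, mul_comm]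
      refine hval.abs_le_of_slabs i m K (fun L hL hw => ?_) (h₁ i (Finset.mem_cons_self i s))
      refine ih L (fun j hj x hx y hy => h₁ j (Finset.mem_cons_of_mem hj) x (hL hx) y (hL hy))
        fun j hj => ?_
      by_cases hji : j = i
      · rwa [hji]
      · exact fun x hx y hy => h₂ j (by simp [hji, hj]) x (hL hx) y (hL hy)
  simpa using key Finset.univ K (fun i _ => hK i) fun i hi => absurd (Finset.mem_univ i) hi

theorem IsValuation.exists_growth_bound (hval : IsValuation Z) (htrans : IsTranslationInvariant Z)
    (hcont : Continuous Z) (K : ConvexBody (Eucl n)) :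
    ∃ A c : ℝ, 0 ≤ c ∧ ∀ k : ℕ, |Z ((k : ℝ) • K)| ≤ A * (c * k + 1) ^ n := by
  obtain ⟨A, -, hA⟩ := htrans.exists_bound_of_unit_width hcont
  obtain ⟨R, hR⟩ := K.isBounded.exists_norm_le
  obtain ⟨w, hw⟩ := exists_nat_ge (2 * R)
  refine ⟨A, 2 * w, by positivity, fun k => ?_⟩
  have h := hval.abs_le_of_width_le hA (k * w) ((k : ℝ) • K) fun i x hx y hy => by
    obtain ⟨a, ha, rfl⟩ := ConvexBody.mem_smul.1 hx
    obtain ⟨b, hb, rfl⟩ := ConvexBody.mem_smul.1 hy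
    have h1 := (le_abs_self _).trans ((PiLp.norm_apply_le a i).trans (hR a ha))
    have h2 := (neg_le_abs _).trans ((PiLp.norm_apply_le b i).trans (hR b hb))
    have h3 : (k : ℝ) * (a i - b i) ≤ k * w :=
      mul_le_mul_of_nonneg_left (by linarith) (Nat.cast_nonneg k)
    simp only [PiLp.smul_apply, smul_eq_mul]
    push_cast
    linarith
  refine h.trans_eq ?_
  push_cast
  ring

/-! ### Interpolation and passage to real dilates of all bodies -/

theorem natCast_add_one_injective : Function.Injective fun i : Fin (n + 1) => ((i : ℕ) : ℝ) + 1 :=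
  fun i j h => by simpa [Fin.ext_iff] using h

/-- The polynomial of degree at most `n` agreeing with `t ↦ Z (t • K)` at `t = 1, …, n + 1`. -/
noncomputable def dilationPolynomial (Z : ConvexBody (Eucl n) → ℝ) (K : ConvexBody (Eucl n)) :
    Polynomial ℝ :=
  Lagrange.interpolate Finset.univ (fun i : Fin (n + 1) => ((i : ℕ) : ℝ) + 1)
    fun i => Z ((((i : ℕ) : ℝ) + 1) • K)

theorem dilationPolynomial_eq_sum (Z : ConvexBody (Eucl n) → ℝ) (K : ConvexBody (Eucl n)) :
    dilationPolynomial Z K = ∑ i : Fin (n + 1), Polynomial.C (Z ((((i : ℕ) : ℝ) + 1) • K)) *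
      Lagrange.basis Finset.univ (fun i : Fin (n + 1) => ((i : ℕ) : ℝ) + 1) i :=
  Lagrange.interpolate_apply _ _ _

theorem degree_dilationPolynomial_lt (Z : ConvexBody (Eucl n) → ℝ) (K : ConvexBody (Eucl n)) :
    (dilationPolynomial Z K).degree < (n + 1 : ℕ) := by
  simpa [dilationPolynomial] using Lagrange.degree_interpolate_lt (s := Finset.univ)
    (fun i : Fin (n + 1) => Z ((((i : ℕ) : ℝ) + 1) • K)) natCast_add_one_injective.injOn

theorem eq_dilationPolynomial {K : ConvexBody (Eucl n)} {q : Polynomial ℝ}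
    (hdeg : q.degree ≤ n)
    (h : ∀ i : Fin (n + 1), q.eval (((i : ℕ) : ℝ) + 1) = Z ((((i : ℕ) : ℝ) + 1) • K)) :
    q = dilationPolynomial Z K := by
  refine Lagrange.eq_interpolate_of_eval_eq _ natCast_add_one_injective.injOn ?_ fun i _ => h i
  rw [Finset.card_univ, Fintype.card_fin]
  exact hdeg.trans_lt (by exact_mod_cast Nat.lt_succ_self n)

theorem continuous_eval_dilationPolynomial (hcont : Continuous Z) (t : ℝ) :
    Continuous fun K => (dilationPolynomial Z K).eval t := by
  simp only [dilationPolynomial_eq_sum, Polynomial.eval_finsetSum, Polynomial.eval_mul,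
    Polynomial.eval_C]
  exact continuous_finsetSum _ fun i _ =>
    (hcont.comp (ConvexBody.continuous_const_smul _)).mul continuous_const

theorem coeff_dilationPolynomial (Z : ConvexBody (Eucl n) → ℝ) (K : ConvexBody (Eucl n)) (j : ℕ) :
    (dilationPolynomial Z K).coeff j = ∑ i : Fin (n + 1), Z ((((i : ℕ) : ℝ) + 1) • K) *
      (Lagrange.basis Finset.univ (fun i : Fin (n + 1) => ((i : ℕ) : ℝ) + 1) i).coeff j := by
  simp only [dilationPolynomial_eq_sum, Polynomial.finsetSum_coeff, Polynomial.coeff_C_mul]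

theorem exists_polynomial_degree_le (hcont : Continuous Z) (htrans : IsTranslationInvariant Z)
    (hval : IsValuation Z) {s : Finset (Eucl n)} (hs : s.Nonempty) {P : ConvexBody (Eucl n)}
    (hP : (P : Set (Eucl n)) = convexHull ℝ (s : Set (Eucl n))) :
    ∃ q : Polynomial ℝ, q.degree ≤ n ∧ ∀ k : ℕ, Z ((k : ℝ) • P) = q.eval (k : ℝ) := by
  obtain ⟨q, hq⟩ := exists_polynomial_of_convexHull s hs Z htrans hval P hP
  obtain ⟨A, c, hc, hA⟩ := hval.exists_growth_bound htrans hcont P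
  exact ⟨q, Polynomial.degree_le_of_abs_eval_le hc fun k => hq k ▸ hA k, hq⟩

/-- The polytope `P / b` has its own polynomial `q` on integer dilates. Since `q (b * X)` matches
`Z` at the interpolation nodes, it is the dilation polynomial of `P`. -/
theorem apply_div_smul_polytope (hcont : Continuous Z) (htrans : IsTranslationInvariant Z)
    (hval : IsValuation Z) {s : Finset (Eucl n)} (hs : s.Nonempty) {P : ConvexBody (Eucl n)}
    (hP : (P : Set (Eucl n)) = convexHull ℝ (s : Set (Eucl n))) (a : ℕ) {b : ℕ} (hb : b ≠ 0) :
    Z (((a : ℝ) / b) • P) = (dilationPolynomial Z P).eval ((a : ℝ) / b) := by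
  classical
  have hb' : (b : ℝ) ≠ 0 := Nat.cast_ne_zero.2 hb
  obtain ⟨q, hdeg, hq⟩ := exists_polynomial_degree_le hcont htrans hval
    (s := s.image fun x => (b : ℝ)⁻¹ • x) (hs.image _) (P := (b : ℝ)⁻¹ • P) (by
      rw [ConvexBody.coe_smul, hP, Finset.coe_image, ← convexHull_smul]
      rfl)
  have hq' : q.comp (Polynomial.C (b : ℝ) * Polynomial.X) = dilationPolynomial Z P := by
    refine eq_dilationPolynomial ?_ fun i => ?_
    · rw [← Polynomial.natDegree_le_iff_degree_le] at hdeg ⊢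
      rwa [Polynomial.natDegree_comp, Polynomial.natDegree_C_mul_X _ hb', mul_one]
    · have h := hq (b * ((i : ℕ) + 1))
      rw [smul_smul] at h
      push_cast at h
      rw [mul_right_comm, mul_inv_cancel₀ hb', one_mul] at h
      simp [h]
  rw [← hq', div_eq_mul_inv, mul_smul, hq]
  simp only [Polynomial.eval_comp, Polynomial.eval_mul, Polynomial.eval_C, Polynomial.eval_X]
  congr 1
  field_simp

theorem apply_smul_eq_eval_dilationPolynomial (hcont : Continuous Z)
    (htrans : IsTranslationInvariant Z) (hval : IsValuation Z) (K : ConvexBody (Eucl n)) {t : ℝ}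
    (ht : 0 ≤ t) : Z (t • K) = (dilationPolynomial Z K).eval t := by
  have hclosed : IsClosed {K | Z (t • K) = (dilationPolynomial Z K).eval t} :=
    isClosed_eq (hcont.comp (ConvexBody.continuous_const_smul t))
      (continuous_eval_dilationPolynomial hcont t)
  refine hclosed.closure_subset (Metric.mem_closure_iff.2 fun ε hε => ?_)
  obtain ⟨s, P, hs, hP, hPK⟩ := K.exists_polytope_dist_le (half_pos hε)
  refine ⟨P, ?_, by rw [dist_comm]; linarith⟩
  -- The rationals `⌊t * b⌋₊ / b` tend to `t`, and both sides are continuous in the dilation factor.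
  have hlim := (tendsto_nat_floor_mul_div_atTop ht).comp (tendsto_natCast_atTop_atTop (R := ℝ))
  refine tendsto_nhds_unique_of_eventuallyEq
    (((hcont.comp P.continuous_smul_const).tendsto t).comp hlim)
    (((dilationPolynomial Z P).continuous.tendsto t).comp hlim) ?_
  filter_upwards [Filter.eventually_ne_atTop 0] with b hb
  exact apply_div_smul_polytope hcont htrans hval hs hP _ hb

theorem dilationPolynomial_smul (hcont : Continuous Z) (htrans : IsTranslationInvariant Z)
    (hval : IsValuation Z) (K : ConvexBody (Eucl n)) {t : ℝ} (ht : 0 ≤ t) :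
    dilationPolynomial Z (t • K)
      = (dilationPolynomial Z K).comp (Polynomial.C t * Polynomial.X) := by
  refine Polynomial.eq_of_infinite_eval_eq _ _ ((Set.Ici_infinite (0 : ℝ)).mono fun s hs => ?_)
  have hs : 0 ≤ s := hs
  change Polynomial.eval _ _ = Polynomial.eval _ _
  rw [← apply_smul_eq_eval_dilationPolynomial hcont htrans hval _ hs, smul_smul,
    apply_smul_eq_eval_dilationPolynomial hcont htrans hval _ (mul_nonneg hs ht)]
  rw [Polynomial.eval_comp, Polynomial.eval_mul, Polynomial.eval_C, Polynomial.eval_X, mul_comm]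

theorem IsValuation.comp_smul (hval : IsValuation Z) {t : ℝ} (ht : t ≠ 0) :
    IsValuation fun K => Z (t • K) := fun P Q U I hU hI =>
  hval _ _ _ _ (by simp only [ConvexBody.coe_smul, hU, Set.smul_set_union])
    (by simp only [ConvexBody.coe_smul, hI, Set.smul_set_inter₀ ht])

theorem mainTheorem4 (n : ℕ) (Z : ConvexBody (Eucl n) → ℝ)
    (hcont : Continuous Z) (htrans : IsTranslationInvariant Z) (hval : IsValuation Z) :
    ∃ Y : Fin (n + 1) → ConvexBody (Eucl n) → ℝ,
      (∀ j : Fin (n + 1), Continuous (Y j) ∧ IsTranslationInvariant (Y j) ∧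
        IsValuation (Y j) ∧ IsHomogeneousOfDegree ((j : ℕ) : ℝ) (Y j)) ∧
      ∀ K : ConvexBody (Eucl n), Z K = ∑ j : Fin (n + 1), Y j K := by
  refine ⟨fun j K => (dilationPolynomial Z K).coeff j, fun j => ⟨?_, ?_, ?_, ?_⟩, fun K => ?_⟩
  · simp only [coeff_dilationPolynomial]
    exact continuous_finsetSum _ fun i _ =>
      (hcont.comp (ConvexBody.continuous_const_smul _)).mul continuous_const
  · intro x K
    simp only [coeff_dilationPolynomial, ConvexBody.smul_translate, htrans _ _]
  · intro P Q U I hU hI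
    simp only [coeff_dilationPolynomial, ← Finset.sum_add_distrib, ← add_mul]
    refine Finset.sum_congr rfl fun i _ => ?_
    -- Nodes starting at `1` are nonzero, so dilation commutes with intersection.
    rw [hval.comp_smul (t := ((i : ℕ) : ℝ) + 1) (by positivity) P Q U I hU hI]
  · intro t K ht
    -- Substituting `t * X` for `X` multiplies the `j`-th coefficient by `t ^ j`.
    simp only [dilationPolynomial_smul hcont htrans hval K ht.le,
      Polynomial.comp_C_mul_X_coeff, Real.rpow_natCast]
    exact mul_comm _ _
  · have h := apply_smul_eq_eval_dilationPolynomial hcont htrans hval K zero_le_one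
    rw [one_smul] at h
    rw [h, Polynomial.eval_eq_sum_range' (n := n + 1), Finset.sum_range]
    · simp
    · rcases eq_or_ne (dilationPolynomial Z K) 0 with h0 | h0
      · simp [h0]
      · exact (Polynomial.natDegree_lt_iff_degree_lt h0).2 (degree_dilationPolynomial_lt Z K)
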